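/- Conventions. Rings are associative and unital. A ring $A$ is regular if every $x\in A$ is of the form $x=xyx$ for some $y\in A$; it is self-injective if it is injective as a right module over itself. A regular ring is a factor if its only central idempotents are $0$ and $1$. An idempotent $e\in A$ is abelian if all idempotents of the ring $eAe$ are central in $eAe$, and faithful if $0$ is the only central idempotent of $A$ orthogonal to $e$; a regular self-injective ring is of type I if it contains a faithful abelian idempotent. $\mathcal M_A^r$ denotes the full subcategory of the category of right $A$-modules consisting of the direct summands of powers $A^I$, for sets $I$. An object $x$ of a category is a singleton for it if every object is a (possibly empty) coproduct of copies of $x$; a category is singleton if it has a singleton. An object is indecomposable if it is non-zero and not the direct sum of two non-zero objects. Proposition. For a non-zero Grothendieck category $\mathcal C$ the following conditions are equivalent: (1) $\mathcal C$ is equivalent to the category of right vector spaces over a division ring $D$. (2) $\mathcal C$ is singleton with an indecomposable singleton object. (3) $\mathcal C$ is singleton, and every regular self-injective ring $A$ such that $\mathcal C\simeq\mathcal M_A^r$ and $A$ is a singleton for $\mathcal M_A^r$ is a division ring. (4) $\mathcal C$ is singleton, and every regular self-injective ring $A$ with $\mathcal C\simeq\mathcal M_A^r$ is a factor of type I. (5)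 $\mathcal C$ is equivalent to $\mathcal M_B^r$ for some regular self-injective type-I factor $B$. -/

import Mathlib

open CategoryTheory CategoryTheory.Limits

universe v u

/-- `x` is a singleton for the category `C`: every object of `C` is a (possibly empty) coproduct
of copies of `x`, indexed by a small set. -/
def IsSingleton {C : Type u} [Category.{v} C] (x : C) : Prop :=
  ∀ X : C, ∃ (S : Type v) (ι : S → (x ⟶ X)), Nonempty (IsColimit (Cofan.mk X ι))

/-- A singleton category: one that has a singleton. -/
def IsSingletonCategory (C : Type u) [Category.{v} C] : Prop :=
  ∃ x : C, IsSingleton x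

/-- Von Neumann regular rings. -/
def IsVonNeumannRegularRing (A : Type u) [Ring A] : Prop :=
  ∀ x : A, ∃ y : A, x = x * y * x

/-- Right self-injective rings. Right `A`-modules are modules over `Aᵐᵒᵖ`. -/
def IsRightSelfInjective (A : Type u) [Ring A] : Prop :=
  Module.Injective Aᵐᵒᵖ A

/-- The ring `A` is a division ring. -/
def IsDivisionRing (A : Type u) [Ring A] : Prop :=
  Nontrivial A ∧ ∀ a : A, a ≠ 0 → IsUnit a

/-- Central idempotents. -/
def IsCentralIdempotent {A : Type u} [Ring A] (e : A) : Prop :=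
  IsIdempotentElem e ∧ e ∈ Subring.center A

/-- A (regular) ring is a factor if its only central idempotents are `0` and `1`. -/
def IsFactor (A : Type u) [Ring A] : Prop :=
  ∀ e : A, IsCentralIdempotent e → e = 0 ∨ e = 1

/-- An abelian idempotent `e`: all idempotents `f` of the corner ring `eAe` are central in `eAe`. -/
def IsAbelianIdempotent {A : Type u} [Ring A] (e : A) : Prop :=
  IsIdempotentElem e ∧
    ∀ f : A, IsIdempotentElem f → e * f * e = f → ∀ a : A, f * (e * a * e) = (e * a * e) * f

/-- A faithful idempotent `e`: the only central idempotent orthogonal to `e` is `0`. -/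
def IsFaithfulIdempotent {A : Type u} [Ring A] (e : A) : Prop :=
  IsIdempotentElem e ∧ ∀ f : A, IsCentralIdempotent f → e * f = 0 → f = 0

/-- A (regular right self-injective) ring is of type I if it contains a faithful abelian
idempotent. -/
def IsTypeI (A : Type u) [Ring A] : Prop :=
  ∃ e : A, IsAbelianIdempotent e ∧ IsFaithfulIdempotent e

/-- The right `A`-modules that are direct summands of powers `A ^ I`, for sets `I`. -/
def isReducedModule (A : Type v) [Ring A] : ObjectProperty (ModuleCat.{v} Aᵐᵒᵖ) :=
  fun M => ∃ (I : Type v) (i : M →ₗ[Aᵐᵒᵖ] (I → A)) (p : (I → A) →ₗ[Aᵐᵒᵖ] M),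
    p ∘ₗ i = LinearMap.id

/-- The category of reduced right `A`-modules: the full subcategory of the category of right
`A`-modules on the direct summands of powers of `A`. -/
abbrev ReducedModuleCat (A : Type v) [Ring A] : Type (v + 1) :=
  (isReducedModule A).FullSubcategory

theorem isReducedModule_self (A : Type v) [Ring A] :
    isReducedModule A (ModuleCat.of Aᵐᵒᵖ A) :=
  ⟨PUnit, LinearMap.pi fun _ => LinearMap.id, LinearMap.proj PUnit.unit, rfl⟩

/-- The right module `A`, as an object of the category of reduced right `A`-modules. -/
def ReducedModuleCat.self (A : Type v) [Ring A] : ReducedModuleCat A :=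
  ⟨ModuleCat.of Aᵐᵒᵖ A, isReducedModule_self A⟩

/-!
The proof rests on two facts about a Grothendieck category `C`.

If `C` has a singleton `x`, then every object of `C` is injective (`IsSingleton.injective`): a
coproduct of copies of `x` is a direct summand of any injective object that contains a coproduct of
sufficiently many copies. Hence images and kernels split off, `End x` is regular, `x` is both a
separator and a coseparator, and every object is a direct summand of a power of `x`. By the
Gabriel-Popescu theorem `Hom(x, -)` is fully faithful and preserves injective objects, so that `End x` is right
self-injective and `C` is the category of reduced right `End x`-modules, with `x` corresponding to
`End x` (`IsSingleton.exists_equivalence_reducedModuleCat`). This makes the universally quantified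
conditions on rings `A` with `C` equivalent to the reduced `A`-modules applicable to `A = End x`.

If `x` is a separator of `C` and `End x` is a division ring, then `Hom(x, -)` is an equivalence onto
the right vector spaces over `End x` (`nonempty_equivalence_of_isSeparator`).

An indecomposable singleton has a division ring of endomorphisms, as its subobjects are direct
summands. In that case a ring `A` such that `C` is equivalent to the reduced `A`-modules is the
endomorphism ring of a non-zero coproduct of copies of `x`; such a ring is a type-I factor
(`isFactor_and_isTypeI_end`), and it is `End x` when `A` itself is a singleton.

Conversely, let `e` be a faithful abelian idempotent of a regular right self-injective factor `B`.
Annihilators of two-sided ideals of `B` are generated by central idempotents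
(`exists_isCentralIdempotent_forall_iff`), so `B` is prime. Therefore `e B` is a separator of the
reduced `B`-modules, and its endomorphism ring `e B e` is a division ring.
-/

/-! ### Coproducts of copies of an object -/

/-- The coordinate projections of a coproduct of copies of `x`. -/
theorem exists_projections_of_isColimit_cofan {C : Type u} [Category.{v} C] [HasZeroMorphisms C]
    {x X : C} {S : Type v} {ι : S → (x ⟶ X)} (h : IsColimit (Cofan.mk X ι)) :
    ∃ π : S → (X ⟶ x), (∀ s, ι s ≫ π s = 𝟙 x) ∧ ∀ s t, s ≠ t → ι s ≫ π t = 0 := by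
  classical
  refine ⟨fun t => Cofan.IsColimit.desc h fun s => if s = t then 𝟙 x else 0, fun s => ?_,
    fun s t hst => ?_⟩
  · simpa using Cofan.IsColimit.fac h (fun r => if r = s then 𝟙 x else 0) s
  · simpa [hst] using Cofan.IsColimit.fac h (fun r => if r = t then 𝟙 x else 0) s

/-- A coproduct of copies of `x` over `S` is a retract of one over `T` when `S` embeds in `T`. -/
theorem nonempty_retract_of_embedding {C : Type u} [Category.{v} C] [HasZeroMorphisms C]
    {x X Y : C} {S T : Type v} {ι : S → (x ⟶ X)} (h : IsColimit (Cofan.mk X ι))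
    {κ : T → (x ⟶ Y)} (k : IsColimit (Cofan.mk Y κ)) (j : S ↪ T) : Nonempty (Retract X Y) := by
  classical
  let r : T → (x ⟶ X) := fun t => if ht : ∃ s, j s = t then ι ht.choose else 0
  have hr (s : S) : r (j s) = ι s := by
    have hs : ∃ s', j s' = j s := ⟨s, rfl⟩
    simp only [r, dif_pos hs]
    rw [j.injective hs.choose_spec]
  refine ⟨⟨Cofan.IsColimit.desc h fun s => κ (j s), Cofan.IsColimit.desc k r, ?_⟩⟩
  refine Cofan.IsColimit.hom_ext h _ _ fun s => ?_
  rw [← Category.assoc, Cofan.IsColimit.fac]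
  refine (Cofan.IsColimit.fac k r (j s)).trans ?_
  rw [hr]
  exact (Category.comp_id _).symm

namespace IsSingleton

/-- A singleton is a retract of every non-zero object. -/
theorem nonempty_retract {C : Type u} [Category.{v} C] [HasZeroMorphisms C] {x : C}
    (hx : IsSingleton x) {X : C} (hX : ¬ IsZero X) : Nonempty (Retract x X) := by
  obtain ⟨S, ι, ⟨h⟩⟩ := hx X
  obtain ⟨π, hπ, -⟩ := exists_projections_of_isColimit_cofan h
  rcases isEmpty_or_nonempty S with hS | ⟨⟨s⟩⟩
  · refine absurd ((IsZero.iff_id_eq_zero X).2 ?_) hX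
    exact Cofan.IsColimit.hom_ext h _ _ fun s => hS.elim s
  · exact ⟨⟨ι s, π s, hπ s⟩⟩

theorem not_isZero {C : Type u} [Category.{v} C] [HasZeroMorphisms C] {x : C}
    (hx : IsSingleton x) {X : C} (hX : ¬ IsZero X) : ¬ IsZero x := by
  intro h0
  obtain ⟨S, ι, ⟨h⟩⟩ := hx X
  refine hX ((IsZero.iff_id_eq_zero X).2 ?_)
  exact Cofan.IsColimit.hom_ext h _ _ fun s => h0.eq_of_src _ _

theorem of_equivalence {C : Type u} [Category.{v} C] {D : Type*} [Category.{v} D] {x : C}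
    (hx : IsSingleton x) (e : C ≌ D) : IsSingleton (e.functor.obj x) := by
  intro Y
  obtain ⟨S, ι, ⟨h⟩⟩ := hx (e.inverse.obj Y)
  have h' := isColimitCofanMkObjOfIsColimit e.functor _ _ h
  refine ⟨S, fun s => e.functor.map (ι s) ≫ (e.counitIso.app Y).hom, ⟨?_⟩⟩
  exact h'.ofIsoColimit (Cofan.ext (e.counitIso.app Y))

theorem of_iso {C : Type u} [Category.{v} C] {x y : C} (hx : IsSingleton x) (e : x ≅ y) :
    IsSingleton y := by
  intro X
  obtain ⟨S, ι, ⟨h⟩⟩ := hx X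
  refine ⟨S, fun s => e.inv ≫ ι s, ⟨Cofan.IsColimit.mk _
    (fun t => Cofan.IsColimit.desc h fun s => e.hom ≫ t.inj s) (fun t s => ?_)
    fun t m hm => Cofan.IsColimit.hom_ext h _ _ fun s => ?_⟩⟩
  · have := Cofan.IsColimit.fac h (fun s => e.hom ≫ t.inj s) s
    simp only [cofan_mk_inj] at this
    simp [this]
  · rw [Cofan.IsColimit.fac, ← hm s]
    simp

theorem isSeparator {C : Type u} [Category.{v} C] {x : C} (hx : IsSingleton x) :
    IsSeparator x := by
  refine (isSeparator_def x).2 fun X Y f g hfg => ?_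
  obtain ⟨S, ι, ⟨h⟩⟩ := hx X
  exact Cofan.IsColimit.hom_ext h _ _ fun s => hfg (ι s)

end IsSingleton

/-! ### Singleton Grothendieck categories are spectral -/

namespace IsSingleton

variable {C : Type u} [Category.{v} C] [Abelian C] [IsGrothendieckAbelian.{v} C] {x : C}

/-- In a singleton Grothendieck category every object is injective. An object `X`, a coproduct
over `S`, is a retract of any injective object that is a coproduct over an index set larger
than `S`, and the only alternative is that every injective object embeds in `X`. The latter is
impossible for an injective object that contains a coproduct with more summands than `X` has
subobjects. -/
theorem injective (hx : IsSingleton x) (X : C) : Injective X := by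
  by_cases hX : IsZero X
  · exact ⟨fun _ _ _ => ⟨0, hX.eq_of_tgt _ _⟩⟩
  have hx0 := hx.not_isZero hX
  let W : Type v := Set (Shrink.{v} (Subobject X))
  let P : C := ∐ fun _ : W => x
  have hP := coproductIsCoproduct fun _ : W => x
  obtain ⟨π, hπ, hπ0⟩ := exists_projections_of_isColimit_cofan hP
  obtain ⟨S, ι, ⟨h⟩⟩ := hx X
  obtain ⟨T, κ, ⟨k⟩⟩ := hx (Injective.under P)
  rcases Function.Embedding.total S T with ⟨⟨j⟩⟩ | ⟨⟨j⟩⟩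
  · obtain ⟨r⟩ := nonempty_retract_of_embedding h k j
    exact r.injective
  · obtain ⟨r⟩ := nonempty_retract_of_embedding k h j
    let m : P ⟶ X := Injective.ι P ≫ r.i
    have (w : W) : Mono (Sigma.ι (fun _ : W => x) w) := by
      have := hπ w
      exact (SplitMono.mk _ this).mono
    refine absurd ?_ (Function.cantor_injective fun w : W =>
      equivShrink.{v} (Subobject X) (Subobject.mk (Sigma.ι (fun _ : W => x) w ≫ m)))
    intro a b hab
    have hab' := (equivShrink.{v} (Subobject X)).injective hab
    by_contra hne
    have hle := Subobject.ofMkLEMk_comp hab'.le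
    rw [← Category.assoc, cancel_mono] at hle
    refine hx0 ((IsZero.iff_id_eq_zero x).2 ?_)
    have h1 := hπ a
    have h2 := hπ0 b a (Ne.symm hne)
    rw [← h1]
    change Sigma.ι (fun _ : W => x) a ≫ π a = 0
    rw [← hle, Category.assoc]
    exact (congrArg _ h2).trans comp_zero

theorem isCoseparator (hx : IsSingleton x) : IsCoseparator x := by
  refine (Preadditive.isCoseparator_iff x).2 fun X Y f hf => ?_
  by_contra hne
  have him : ¬ IsZero (Abelian.image f) := fun h0 => hne <| by
    rw [← Abelian.image.fac f, h0.eq_of_tgt (Abelian.factorThruImage f) 0, zero_comp]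
  obtain ⟨r⟩ := hx.nonempty_retract him
  have := hx.injective x
  have h1 : Abelian.factorThruImage f ≫ r.r = 0 := by
    rw [← Injective.comp_factorThru r.r (Abelian.image.ι f), ← Category.assoc, Abelian.image.fac]
    exact hf _
  have h2 : r.r = 0 := (cancel_epi (Abelian.factorThruImage f)).1 (by rw [h1, comp_zero])
  refine hx.not_isZero him ((IsZero.iff_id_eq_zero x).2 ?_)
  rw [← r.retract, h2, comp_zero]

/-- The endomorphism ring of a singleton is regular, because all images split off. -/
theorem isVonNeumannRegularRing_end (hx : IsSingleton x) : IsVonNeumannRegularRing (End x) := by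
  intro f
  let i := Abelian.image.ι f.asHom
  let p := Abelian.factorThruImage f.asHom
  have hfac : p ≫ i = f.asHom := Abelian.image.fac _
  have hI : Injective (Abelian.image f.asHom) := hx.injective _
  have hK : Injective (kernel p) := hx.injective _
  let r := Injective.factorThru (𝟙 _) i
  have hr : i ≫ r = 𝟙 _ := Injective.comp_factorThru _ _
  let q := Injective.factorThru (𝟙 _) (kernel.ι p)
  have hq : kernel.ι p ≫ q = 𝟙 _ := Injective.comp_factorThru _ _
  -- `q` splits the kernel off, so that `𝟙 x - q ≫ kernel.ι p` yields a section `s` of `p`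
  let s := Abelian.epiDesc p (𝟙 x - q ≫ kernel.ι p) (by
    rw [Preadditive.comp_sub, reassoc_of% hq, Category.comp_id, sub_self])
  have hs : p ≫ s = 𝟙 x - q ≫ kernel.ι p := Abelian.comp_epiDesc _ _ _
  refine ⟨End.of (r ≫ s), End.ext ?_⟩
  change f.asHom = f.asHom ≫ (r ≫ s) ≫ f.asHom
  have key : p ≫ i = (p ≫ i) ≫ (r ≫ s) ≫ (p ≫ i) := by
    simp only [Category.assoc]
    rw [reassoc_of% hr, reassoc_of% hs, Preadditive.sub_comp]
    simp
  simpa only [hfac] using key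

/-- Every object embeds in a power of the coseparator `x`, and the embedding splits as all objects
are injective. -/
theorem nonempty_retract_pi (hx : IsSingleton x) (X : C) :
    Nonempty (Retract X (∏ᶜ fun _ : X ⟶ x => x)) := by
  have := (isCoseparator_iff_mono x).1 hx.isCoseparator X
  have := hx.injective X
  exact ⟨⟨_, Injective.factorThru (𝟙 X) (Pi.lift fun f : X ⟶ x => f),
    Injective.comp_factorThru _ _⟩⟩

end IsSingleton

/-! ### The functor represented by a singleton -/

section Coyoneda

variable {C : Type u} [Category.{v} C] [Abelian C]

/-- `Hom(x, x)` is the right module `End x`. -/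
def coyonedaObjSelfEquiv (x : C) :
    (preadditiveCoyonedaObj x).obj x ≃ₗ[(End x)ᵐᵒᵖ] End x where
  toFun f := f
  invFun f := f
  map_add' _ _ := rfl
  map_smul' _ _ := rfl
  left_inv _ := rfl
  right_inv _ := rfl

/-- `Hom(x, xᴵ)` is the power `(End x)ᴵ`. -/
noncomputable def coyonedaObjPiEquiv [HasProducts.{v} C] (x : C) (I : Type v) :
    (preadditiveCoyonedaObj x).obj (∏ᶜ fun _ : I => x) ≃ₗ[(End x)ᵐᵒᵖ] (I → End x) where
  toFun f i := (f : x ⟶ ∏ᶜ fun _ : I => x) ≫ Pi.π _ i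
  invFun g := Pi.lift fun i => g i
  map_add' f g := funext fun i => Preadditive.add_comp _ _ _ _ _ _
  map_smul' a f := funext fun i => Category.assoc _ _ _
  left_inv f := by
    apply Pi.hom_ext
    intro i
    exact limit.lift_π _ _
  right_inv g := funext fun i => limit.lift_π _ _

variable [IsGrothendieckAbelian.{v} C] {x : C}

theorem IsSingleton.isRightSelfInjective_end (hx : IsSingleton x) :
    IsRightSelfInjective (End x) := by
  have := IsGrothendieckAbelian.GabrielPopescu.preservesInjectiveObjects x hx.isSeparator
  have := hx.injective x
  have h1 : Injective ((preadditiveCoyonedaObj x).obj x) := inferInstance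
  have h2 : Injective (ModuleCat.of (End x)ᵐᵒᵖ (End x)) :=
    (Injective.iso_iff (coyonedaObjSelfEquiv x).toModuleIso).1 h1
  exact (Module.injective_iff_injective_object _ _).2 h2

theorem IsSingleton.isReducedModule_coyonedaObj (hx : IsSingleton x) (X : C) :
    isReducedModule (End x) ((preadditiveCoyonedaObj x).obj X) := by
  obtain ⟨r⟩ := hx.nonempty_retract_pi X
  let r' := r.map (preadditiveCoyonedaObj x)
  refine ⟨X ⟶ x, (coyonedaObjPiEquiv x _).toLinearMap ∘ₗ r'.i.hom,
    r'.r.hom ∘ₗ (coyonedaObjPiEquiv x _).symm.toLinearMap, ?_⟩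
  ext m
  simp only [LinearMap.coe_comp, LinearEquiv.coe_coe, Function.comp_apply,
    LinearEquiv.symm_apply_apply, LinearMap.id_coe, id_eq]
  exact ConcreteCategory.congr_hom r'.retract m

/-- A direct summand of a power of `End x` is the image of an idempotent of `Hom(x, xᴵ)`, which
comes from an idempotent of `xᴵ` as `Hom(x, -)` is fully faithful. -/
theorem exists_coyonedaObj_iso_of_isReducedModule (hx : IsSeparator x)
    {M : ModuleCat.{v} (End x)ᵐᵒᵖ} (hM : isReducedModule (End x) M) :
    ∃ X : C, Nonempty ((preadditiveCoyonedaObj x).obj X ≅ M) := by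
  have := IsGrothendieckAbelian.GabrielPopescu.full x hx
  have := (isSeparator_iff_faithful_preadditiveCoyonedaObj x).1 hx
  obtain ⟨I, i, p, hip⟩ := hM
  let F := preadditiveCoyonedaObj x
  let P : C := ∏ᶜ fun _ : I => x
  let i' : M ⟶ F.obj P := ModuleCat.ofHom ((coyonedaObjPiEquiv x I).symm.toLinearMap ∘ₗ i)
  let p' : F.obj P ⟶ M := ModuleCat.ofHom (p ∘ₗ (coyonedaObjPiEquiv x I).toLinearMap)
  have hip' : i' ≫ p' = 𝟙 M := by
    ext m
    change p (coyonedaObjPiEquiv x I ((coyonedaObjPiEquiv x I).symm (i m))) = m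
    rw [LinearEquiv.apply_symm_apply]
    exact LinearMap.congr_fun hip m
  obtain ⟨q, hq⟩ := F.map_surjective (p' ≫ i')
  have hqq : q ≫ q = q := F.map_injective (by
    rw [F.map_comp, hq, Category.assoc, reassoc_of% hip'])
  obtain ⟨X, j, e, hje, hej⟩ := IsIdempotentComplete.idempotents_split P q hqq
  have h1 : F.map j ≫ F.map e = 𝟙 _ := by rw [← F.map_comp, hje, F.map_id]
  have h2 : F.map e ≫ F.map j = p' ≫ i' := by rw [← F.map_comp, hej, hq]
  refine ⟨X, ⟨⟨F.map j ≫ p', i' ≫ F.map e, ?_, ?_⟩⟩⟩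
  · rw [Category.assoc, ← reassoc_of% h2, h1, reassoc_of% h1]
  · rw [Category.assoc, reassoc_of% h2, hip', Category.comp_id, hip']

/-- A Grothendieck category with a singleton `x` is the category of reduced right modules over
`End x`, and the equivalence takes `x` to `End x`. -/
theorem IsSingleton.exists_equivalence_reducedModuleCat (hx : IsSingleton x) :
    ∃ e : C ≌ ReducedModuleCat (End x),
      Nonempty (e.functor.obj x ≅ ReducedModuleCat.self (End x)) := by
  have := IsGrothendieckAbelian.GabrielPopescu.full x hx.isSeparator
  have := (isSeparator_iff_faithful_preadditiveCoyonedaObj x).1 hx.isSeparator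
  let F : C ⥤ ReducedModuleCat (End x) :=
    (isReducedModule (End x)).lift (preadditiveCoyonedaObj x) hx.isReducedModule_coyonedaObj
  have : F.EssSurj := ⟨fun M => by
    obtain ⟨X, ⟨e⟩⟩ := exists_coyonedaObj_iso_of_isReducedModule hx.isSeparator M.property
    exact ⟨X, ⟨ObjectProperty.isoMk _ e⟩⟩⟩
  have : F.IsEquivalence := { }
  exact ⟨F.asEquivalence, ⟨ObjectProperty.isoMk _ (coyonedaObjSelfEquiv x).toModuleIso⟩⟩

end Coyoneda

/-! ### Invariance under multiplicative equivalences -/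

section MulEquiv

variable {A B : Type*} [Ring A] [Ring B]

theorem IsDivisionRing.of_mulEquiv (φ : A ≃* B) (hA : IsDivisionRing A) : IsDivisionRing B := by
  obtain ⟨hA1, hA2⟩ := hA
  refine ⟨φ.injective.nontrivial, fun b hb => ?_⟩
  rw [← φ.apply_symm_apply b]
  exact (hA2 _ fun h => hb (by simpa using h)).map φ

theorem IsCentralIdempotent.map_mulEquiv (φ : A ≃* B) {e : A} (he : IsCentralIdempotent e) :
    IsCentralIdempotent (φ e) := by
  refine ⟨he.1.map φ, Subring.mem_center_iff.2 fun b => ?_⟩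
  obtain ⟨a, rfl⟩ := φ.surjective b
  rw [← map_mul, ← map_mul, Subring.mem_center_iff.1 he.2 a]

theorem IsFactor.of_mulEquiv (φ : A ≃* B) (hA : IsFactor A) : IsFactor B := by
  intro e he
  rcases hA _ (he.map_mulEquiv φ.symm) with h | h
  · left
    simpa using h
  · right
    simpa using h

theorem IsTypeI.of_mulEquiv (φ : A ≃* B) (hA : IsTypeI A) : IsTypeI B := by
  obtain ⟨e, ⟨he, hab⟩, -, hf⟩ := hA
  refine ⟨φ e, ⟨he.map φ, fun f hf hef b => ?_⟩, he.map φ, fun f hf' hef => ?_⟩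
  · have := hab (φ.symm f) (hf.map φ.symm) (φ.injective (by simpa using hef)) (φ.symm b)
    simpa using congrArg φ this
  · have := hf _ (hf'.map_mulEquiv φ.symm) (φ.injective (by simpa using hef))
    simpa using this

end MulEquiv

/-! ### Regular right self-injective factors of type I -/

section Ring

variable {B : Type v} [Ring B]

theorem IsVonNeumannRegularRing.eq_zero (hB : IsVonNeumannRegularRing B) {x : B}
    (hx : ∀ b, x * b * x = 0) : x = 0 := by
  obtain ⟨y, hy⟩ := hB x
  rw [hy, hx]

/-- The right annihilator `J` of the two-sided ideal generated by `c` is generated by a central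
idempotent. With `I` the left annihilator of `J`, the projection of `I ⊕ J` to `J` extends to the
left multiplication by some `g`, and an element that annihilates both `I` and `J` from the left
is zero. -/
theorem exists_isCentralIdempotent_forall_iff (hB : IsVonNeumannRegularRing B)
    (hinj : IsRightSelfInjective B) (c : B) :
    ∃ g : B, IsCentralIdempotent g ∧ ∀ j, (∀ b, c * b * j = 0) ↔ g * j = j := by
  let J : Submodule Bᵐᵒᵖ B :=
    { carrier := {j | ∀ b, c * b * j = 0}
      add_mem' := fun {x y} hx hy b => by rw [mul_add, hx, hy, add_zero]
      zero_mem' := fun b => mul_zero _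
      smul_mem' := fun r x hx b => by
        rw [MulOpposite.smul_eq_mul_unop, ← mul_assoc, hx, zero_mul] }
  let I : Submodule Bᵐᵒᵖ B :=
    { carrier := {i | ∀ j ∈ J, ∀ b, i * b * j = 0}
      add_mem' := fun {x y} hx hy j hj b => by rw [add_mul, add_mul, hx j hj, hy j hj, add_zero]
      zero_mem' := fun j _ b => by rw [zero_mul, zero_mul]
      smul_mem' := fun r x hx j hj b => by
        rw [MulOpposite.smul_eq_mul_unop, mul_assoc x, hx j hj] }
  have hJl (b : B) {j : B} (hj : j ∈ J) : b * j ∈ J := fun b' => by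
    rw [← mul_assoc, mul_assoc c]
    exact hj _
  have hIl (b : B) {i : B} (hi : i ∈ I) : b * i ∈ I := fun j hj b' => by
    rw [mul_assoc b, mul_assoc b, hi j hj, mul_zero]
  have hzero (x : B) (hxI : ∀ i ∈ I, x * i = 0) (hxJ : ∀ j ∈ J, x * j = 0) : x = 0 := by
    have hx : x ∈ I := fun j hj b => by rw [mul_assoc, hxJ _ (hJl b hj)]
    exact hB.eq_zero fun b => by rw [mul_assoc, hxI _ (hIl b hx)]
  let f : I × J →ₗ[Bᵐᵒᵖ] B := I.subtype.coprod J.subtype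
  have hf : Function.Injective f := by
    refine (injective_iff_map_eq_zero f).2 fun ⟨⟨i, hi⟩, ⟨j, hj⟩⟩ h => ?_
    have hij : i + j = 0 := by simpa [f] using h
    have hj0 : j = 0 := by
      have hji : j ∈ I := by
        rw [← neg_eq_of_add_eq_zero_right hij]
        exact I.neg_mem hi
      exact hB.eq_zero fun b => hji j hj b
    subst hj0
    have hi0 : i = 0 := by simpa using hij
    subst hi0
    rfl
  have hinj' : Module.Injective Bᵐᵒᵖ B := hinj
  obtain ⟨h, hh⟩ := hinj'.out f hf (J.subtype ∘ₗ LinearMap.snd _ _ _)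
  have hmul (a : B) : h a = h 1 * a := by
    simpa [MulOpposite.smul_eq_mul_unop] using h.map_smul (MulOpposite.op a) 1
  obtain ⟨g, hg⟩ : ∃ g, ∀ a, h a = g * a := ⟨h 1, hmul⟩
  have hgI {i : B} (hi : i ∈ I) : g * i = 0 := by
    rw [← hg]
    simpa [f] using hh (⟨i, hi⟩, 0)
  have hgJ {j : B} (hj : j ∈ J) : g * j = j := by
    rw [← hg]
    simpa [f] using hh (0, ⟨j, hj⟩)
  have hgmem : g ∈ J := fun b => hzero _
    (fun i hi => by rw [mul_assoc, hgI hi, mul_zero])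
    (fun j hj => by rw [mul_assoc, hgJ hj, hj])
  refine ⟨g, ⟨hgJ hgmem, Subring.mem_center_iff.2 fun b => ?_⟩, fun j =>
    ⟨fun hj => hgJ hj, fun hj => ?_⟩⟩
  · refine sub_eq_zero.1 (hzero _ (fun i hi => ?_) fun j hj => ?_)
    · rw [sub_mul, mul_assoc, mul_assoc, hgI hi, hgI (hIl b hi), mul_zero, sub_zero]
    · rw [sub_mul, mul_assoc, mul_assoc, hgJ hj, hgJ (hJl b hj), sub_self]
  · rw [← hj]
    intro b
    rw [← mul_assoc, hgmem, zero_mul]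

/-- A regular right self-injective factor is a prime ring. -/
theorem IsFactor.eq_zero_or_eq_zero (hF : IsFactor B) (hB : IsVonNeumannRegularRing B)
    (hinj : IsRightSelfInjective B) {x y : B} (h : ∀ b, x * b * y = 0) : x = 0 ∨ y = 0 := by
  obtain ⟨g, hg, hgJ⟩ := exists_isCentralIdempotent_forall_iff hB hinj x
  rcases hF g hg with rfl | rfl
  · right
    simpa using ((hgJ y).1 h).symm
  · left
    simpa using (hgJ 1).2 (mul_one 1) 1

/-- An abelian idempotent `e` of a prime ring has no proper non-zero subidempotent `f`: as `f` is
central in `e B e`, the product `f B (e - f)` vanishes. -/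
theorem IsAbelianIdempotent.eq_zero_or_eq (hF : IsFactor B) (hB : IsVonNeumannRegularRing B)
    (hinj : IsRightSelfInjective B) {e f : B} (he : IsAbelianIdempotent e)
    (hf : IsIdempotentElem f) (hef : e * f * e = f) : f = 0 ∨ f = e := by
  have hee : e * e = e := he.1
  have hff : f * f = f := hf
  have h1 : f * e = f := by rw [← hef, mul_assoc, hee]
  have h2 : e * f = f := by rw [← hef, ← mul_assoc, ← mul_assoc, hee]
  have := hF.eq_zero_or_eq_zero hB hinj (x := f) (y := e - f) fun b => by
    calc f * b * (e - f) = f * e * b * (e * (e - f)) := by rw [h1, mul_sub e e f, hee, h2]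
      _ = f * (e * b * e) * (e - f) := by simp only [mul_assoc]
      _ = e * b * e * (f * (e - f)) := by rw [he.2 f hf hef b, mul_assoc]
      _ = 0 := by rw [mul_sub, h1, hff, sub_self, mul_zero]
  exact this.imp_right fun h => (sub_eq_zero.1 h).symm

/-- The corner ring of an abelian idempotent is a division ring. -/
theorem IsAbelianIdempotent.exists_inverse (hF : IsFactor B) (hB : IsVonNeumannRegularRing B)
    (hinj : IsRightSelfInjective B) {e c : B} (he : IsAbelianIdempotent e)
    (hc : c ≠ 0) (hec : e * c = c) (hce : c * e = c) :
    ∃ d, e * d = d ∧ c * d = e ∧ d * c = e := by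
  have hee : e * e = e := he.1
  obtain ⟨y, hy⟩ := hB c
  have hy' : c * (e * y * e) * c = c := by
    calc c * (e * y * e) * c = (c * e) * y * (e * c) := by simp only [mul_assoc]
      _ = c := by rw [hec, hce, ← hy]
  have hdl : e * (e * y * e) = e * y * e := by rw [← mul_assoc, ← mul_assoc, hee]
  have hdr : (e * y * e) * e = e * y * e := by rw [mul_assoc, hee]
  generalize e * y * e = d at hy' hdl hdr
  refine ⟨d, hdl, ?_, ?_⟩
  · refine (he.eq_zero_or_eq hF hB hinj (f := c * d) ?_ ?_).resolve_left fun h => hc ?_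
    · rw [IsIdempotentElem, ← mul_assoc, hy']
    · rw [← mul_assoc, hec, mul_assoc, hdr]
    · rw [← hy', h, zero_mul]
  · refine (he.eq_zero_or_eq hF hB hinj (f := d * c) ?_ ?_).resolve_left fun h => hc ?_
    · rw [IsIdempotentElem, mul_assoc, ← mul_assoc c, hy']
    · rw [← mul_assoc, hdl, mul_assoc, hce]
    · rw [← hy', mul_assoc, h, mul_zero]

/-- The right ideal `e B` of an idempotent `e`, described as the set of fixed points of the left
multiplication by `e`. -/
def fixedRightIdeal (e : B) : Submodule Bᵐᵒᵖ B where
  carrier := {a | e * a = a}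
  add_mem' {x y} hx hy := by
    change e * x = x at hx
    change e * y = y at hy
    change e * (x + y) = x + y
    rw [mul_add, hx, hy]
  zero_mem' := mul_zero _
  smul_mem' r x hx := by
    change e * x = x at hx
    change e * (r • x) = r • x
    rw [MulOpposite.smul_eq_mul_unop, ← mul_assoc, hx]

theorem mem_fixedRightIdeal {e a : B} : a ∈ fixedRightIdeal e ↔ e * a = a := Iff.rfl

/-- Left multiplication by an element `d` of `e B`, as an endomorphism of `e B`. -/
def fixedRightIdealMulLeft {e d : B} (hd : e * d = d) : Module.End Bᵐᵒᵖ (fixedRightIdeal e) where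
  toFun a := ⟨d * a, by rw [mem_fixedRightIdeal, ← mul_assoc, hd]⟩
  map_add' a b := Subtype.ext (mul_add _ _ _)
  map_smul' r a := Subtype.ext (mul_assoc _ _ _).symm

/-- Schur's lemma for `e B`: its endomorphism ring is a division ring. -/
theorem IsAbelianIdempotent.isDivisionRing_end (hF : IsFactor B) (hB : IsVonNeumannRegularRing B)
    (hinj : IsRightSelfInjective B) {e : B} (he : IsAbelianIdempotent e) (he0 : e ≠ 0) :
    IsDivisionRing (Module.End Bᵐᵒᵖ (fixedRightIdeal e)) := by
  have hee : e * e = e := he.1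
  let e' : fixedRightIdeal e := ⟨e, hee⟩
  have he' : e' ≠ 0 := fun h => he0 (congrArg Subtype.val h)
  refine ⟨⟨⟨0, 1, fun h => he' (LinearMap.congr_fun h e').symm⟩⟩, fun f hf => ?_⟩
  -- an endomorphism is the left multiplication by its value at `e`
  have hfmul (a : fixedRightIdeal e) : (f a : B) = f e' * a := by
    have h1 : a = MulOpposite.op (a : B) • e' := Subtype.ext a.2.symm
    conv_lhs => rw [h1, map_smul]
    rfl
  obtain ⟨d, hed, hcd, hdc⟩ := he.exists_inverse hF hB hinj (c := f e')
    (fun h => hf (LinearMap.ext fun a => Subtype.ext (by rw [hfmul, h, zero_mul]; rfl)))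
    (f e').2 (hfmul e').symm
  refine ⟨⟨f, fixedRightIdealMulLeft hed, ?_, ?_⟩, rfl⟩
  · refine LinearMap.ext fun a => Subtype.ext ?_
    change (f (fixedRightIdealMulLeft hed a) : B) = a
    rw [hfmul]
    change f e' * (d * (a : B)) = a
    rw [← mul_assoc, hcd, a.2]
  · refine LinearMap.ext fun a => Subtype.ext ?_
    change d * (f a : B) = a
    rw [hfmul, ← mul_assoc, hdc, a.2]

theorem isReducedModule_fixedRightIdeal {e : B} (he : IsIdempotentElem e) :
    isReducedModule B (ModuleCat.of Bᵐᵒᵖ (fixedRightIdeal e)) := by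
  let p : B →ₗ[Bᵐᵒᵖ] fixedRightIdeal e :=
    { toFun := fun a => ⟨e * a, by rw [mem_fixedRightIdeal, ← mul_assoc, he]⟩
      map_add' := fun a b => Subtype.ext (mul_add _ _ _)
      map_smul' := fun r a => Subtype.ext (mul_assoc _ _ _).symm }
  exact ⟨PUnit, LinearMap.pi fun _ => (fixedRightIdeal e).subtype,
    p ∘ₗ LinearMap.proj PUnit.unit, LinearMap.ext fun a => Subtype.ext a.2⟩

/-- The right ideal `e B` separates reduced modules as soon as `b B e = 0` forces `b = 0`, because
reduced modules embed in powers of `B`. -/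
theorem isSeparator_fixedRightIdeal {e : B} (he : IsIdempotentElem e)
    (hfaith : ∀ b : B, (∀ a, b * a * e = 0) → b = 0) :
    IsSeparator (C := ReducedModuleCat B) ⟨_, isReducedModule_fixedRightIdeal he⟩ := by
  refine (isSeparator_def _).2 fun X Y f g hfg => ?_
  obtain ⟨I, i, p, hip⟩ := Y.property
  have hi (y : Y.obj) (hy : i y = 0) : y = 0 := by
    rw [← LinearMap.id_apply (R := Bᵐᵒᵖ) y, ← hip, LinearMap.comp_apply, hy, map_zero]
  refine ObjectProperty.hom_ext _ (ModuleCat.hom_ext (LinearMap.ext fun m => ?_))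
  refine sub_eq_zero.1 (hi _ (funext fun k => hfaith _ fun a => ?_))
  -- the morphism `e B ⟶ X` with value `m a e` at `e`
  let h : fixedRightIdeal e →ₗ[Bᵐᵒᵖ] X.obj :=
    { toFun := fun z => MulOpposite.op (a * (z : B)) • m
      map_add' := fun z w => by
        rw [Submodule.coe_add, mul_add, MulOpposite.op_add, add_smul]
      map_smul' := fun r z => by
        rw [RingHom.id_apply, smul_smul, Submodule.coe_smul, MulOpposite.smul_eq_mul_unop,
          ← mul_assoc, MulOpposite.op_mul, MulOpposite.op_unop] }
  have h1 := hfg (ObjectProperty.homMk (ModuleCat.ofHom h) :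
    (⟨_, isReducedModule_fixedRightIdeal he⟩ : ReducedModuleCat B) ⟶ X)
  have h2 : f.hom.hom (MulOpposite.op (a * e) • m) = g.hom.hom (MulOpposite.op (a * e) • m) :=
    congrArg (fun φ => φ.hom.hom (⟨e, he⟩ : fixedRightIdeal e)) h1
  rw [map_smul, map_smul, ← sub_eq_zero, ← smul_sub] at h2
  have h3 := congrFun (congrArg i h2) k
  rw [map_smul, map_zero, Pi.smul_apply, MulOpposite.smul_eq_mul_unop, MulOpposite.unop_op,
    ← mul_assoc] at h3
  exact h3

end Ring

/-! ### Indecomposable objects and division rings -/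

theorem IsDivisionRing.eq_zero_or_eq_one {A : Type*} [Ring A] (hA : IsDivisionRing A) {a : A}
    (ha : IsIdempotentElem a) : a = 0 ∨ a = 1 := by
  by_cases h : a = 0
  · exact Or.inl h
  · exact Or.inr ((IsIdempotentElem.iff_eq_one_of_isUnit (hA.2 a h)).1 ha)

section Abelian

variable {C : Type u} [Category.{v} C] [Abelian C]

theorem IsDivisionRing.not_isZero {x : C} (h : IsDivisionRing (End x)) : ¬ IsZero x := by
  have := h.1
  exact fun h0 => one_ne_zero (α := End x) ((IsZero.iff_id_eq_zero x).1 h0)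

theorem IsDivisionRing.indecomposable {x : C} (h : IsDivisionRing (End x)) :
    Indecomposable x := by
  refine ⟨h.not_isZero, fun Y Z a => ?_⟩
  let f : End x := End.of (a.hom ≫ biprod.fst ≫ biprod.inl ≫ a.inv)
  have hf : IsIdempotentElem f := by
    change (a.hom ≫ biprod.fst ≫ biprod.inl ≫ a.inv) ≫ (a.hom ≫ biprod.fst ≫ biprod.inl ≫ a.inv) =
      a.hom ≫ biprod.fst ≫ biprod.inl ≫ a.inv
    simp
  rcases h.eq_zero_or_eq_one hf with h0 | h1
  · left
    have h0' : a.hom ≫ biprod.fst ≫ biprod.inl ≫ a.inv = 0 := h0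
    rw [IsZero.iff_id_eq_zero]
    calc 𝟙 Y = biprod.inl ≫ a.inv ≫ (a.hom ≫ biprod.fst ≫ biprod.inl ≫ a.inv) ≫ a.hom ≫
          biprod.fst := by simp
      _ = 0 := by rw [h0']; simp
  · right
    have h1' : a.hom ≫ biprod.fst ≫ biprod.inl ≫ a.inv = 𝟙 x := h1
    rw [IsZero.iff_id_eq_zero]
    calc 𝟙 Z = biprod.inr ≫ a.inv ≫ 𝟙 x ≫ a.hom ≫ biprod.snd := by simp
      _ = 0 := by rw [← h1']; simp

/-- A non-zero retract of an object with a division ring of endomorphisms is the whole object. -/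
theorem IsDivisionRing.nonempty_iso_of_retract {x y : C} (h : IsDivisionRing (End x))
    (r : Retract y x) (hy : ¬ IsZero y) : Nonempty (y ≅ x) := by
  have hf : IsIdempotentElem (End.of (r.r ≫ r.i)) := by
    change (r.r ≫ r.i) ≫ r.r ≫ r.i = r.r ≫ r.i
    simp
  rcases h.eq_zero_or_eq_one hf with h0 | h1
  · refine absurd ((IsZero.iff_id_eq_zero y).2 ?_) hy
    have h0' : r.r ≫ r.i = 0 := h0
    calc 𝟙 y = r.i ≫ (r.r ≫ r.i) ≫ r.r := by simp
      _ = 0 := by rw [h0']; simp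
  · exact ⟨⟨r.i, r.r, r.retract, h1⟩⟩

/-- The endomorphisms of a coproduct of copies of `x` form a type-I factor if `End x` is a
division ring. The projection onto any of the summands is a faithful abelian idempotent, and a
central element restricts to the same endomorphism of `x` on all summands. -/
theorem isFactor_and_isTypeI_end {x X : C} (hx : IsDivisionRing (End x)) (hX : ¬ IsZero X)
    {S : Type v} {ι : S → (x ⟶ X)} (h : IsColimit (Cofan.mk X ι)) :
    IsFactor (End X) ∧ IsTypeI (End X) := by
  obtain ⟨π, hπ, -⟩ := exists_projections_of_isColimit_cofan h
  have hext {f g : X ⟶ X} (hfg : ∀ s, ι s ≫ f = ι s ≫ g) : f = g :=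
    Cofan.IsColimit.hom_ext h f g hfg
  obtain ⟨s⟩ : Nonempty S := by
    by_contra hS
    rw [not_nonempty_iff] at hS
    exact hX ((IsZero.iff_id_eq_zero X).2 (hext fun s => hS.elim s))
  let e : X ⟶ X := π s ≫ ι s
  have hee : e ≫ e = e := by simp [e, reassoc_of% hπ s]
  have he0 : e ≠ 0 := fun h0 => hx.not_isZero <| by
    rw [IsZero.iff_id_eq_zero]
    calc 𝟙 x = ι s ≫ e ≫ π s := by simp [e, hπ s]
      _ = 0 := by simp [h0]
  have hfactor : IsFactor (End X) := by
    rintro (f : X ⟶ X) ⟨hff, hfc⟩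
    replace hff : f ≫ f = f := hff
    replace hfc (g : X ⟶ X) : f ≫ g = g ≫ f := Subring.mem_center_iff.1 hfc g
    have hc (t : S) : ι t ≫ f = (ι s ≫ f ≫ π s) ≫ ι t := by
      calc ι t ≫ f = ι t ≫ (π t ≫ ι s) ≫ (π s ≫ ι t) ≫ f := by
            simp [reassoc_of% hπ t, reassoc_of% hπ s]
        _ = ι t ≫ (π t ≫ ι s) ≫ f ≫ π s ≫ ι t := by rw [hfc]
        _ = (ι s ≫ f ≫ π s) ≫ ι t := by simp [reassoc_of% hπ t]
    have hidem : IsIdempotentElem (End.of (ι s ≫ f ≫ π s)) := by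
      change (ι s ≫ f ≫ π s) ≫ ι s ≫ f ≫ π s = ι s ≫ f ≫ π s
      calc (ι s ≫ f ≫ π s) ≫ ι s ≫ f ≫ π s = ((ι s ≫ f ≫ π s) ≫ ι s) ≫ f ≫ π s := by simp
        _ = (ι s ≫ f) ≫ f ≫ π s := by rw [← hc s]
        _ = ι s ≫ f ≫ π s := by rw [Category.assoc, reassoc_of% hff]
    rcases hx.eq_zero_or_eq_one hidem with h0 | h1
    · left
      have h0' : ι s ≫ f ≫ π s = 0 := h0
      exact hext fun t => by rw [hc, h0', zero_comp, comp_zero]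
    · right
      have h1' : ι s ≫ f ≫ π s = 𝟙 x := h1
      exact hext fun t => by rw [hc, h1', Category.id_comp]; exact (Category.comp_id _).symm
  refine ⟨hfactor, End.of e, ⟨hee, ?_⟩, hee, fun f hf hef => ?_⟩
  · rintro (f : X ⟶ X) hff hef (a : X ⟶ X)
    replace hff : f ≫ f = f := hff
    replace hef : e ≫ f ≫ e = f := hef
    change (e ≫ a ≫ e) ≫ f = f ≫ e ≫ a ≫ e
    have hfact : f = π s ≫ (ι s ≫ f ≫ π s) ≫ ι s := by simpa [e] using hef.symm
    have hidem : IsIdempotentElem (End.of (ι s ≫ f ≫ π s)) := by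
      change (ι s ≫ f ≫ π s) ≫ ι s ≫ f ≫ π s = ι s ≫ f ≫ π s
      calc (ι s ≫ f ≫ π s) ≫ ι s ≫ f ≫ π s = ι s ≫ f ≫ (e ≫ f ≫ e) ≫ π s := by
            simp [e, hπ s]
        _ = ι s ≫ f ≫ π s := by rw [hef, reassoc_of% hff]
    rcases hx.eq_zero_or_eq_one hidem with h0 | h1
    · have h0' : ι s ≫ f ≫ π s = 0 := h0
      rw [hfact, h0']
      simp
    · have h1' : ι s ≫ f ≫ π s = 𝟙 x := h1
      have hfe : f = e := by rw [hfact, h1', Category.id_comp]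
      rw [hfe]
      simp only [Category.assoc, hee, reassoc_of% hee]
  · refine (hfactor f hf).resolve_right ?_
    rintro rfl
    exact he0 ((mul_one (End.of e)).symm.trans hef)

end Abelian

section Grothendieck

variable {C : Type u} [Category.{v} C] [Abelian C]

/-- A non-zero direct summand of an indecomposable object is the whole object. -/
theorem CategoryTheory.Indecomposable.isIso_of_isSplitMono {x y : C} (hx : Indecomposable x)
    (i : y ⟶ x) [IsSplitMono i] (hy : ¬ IsZero y) : IsIso i := by
  let b := isBilimitBinaryBiconeOfIsSplitMonoOfCokernel (cokernelIsCokernel i)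
  have h0 := (hx.2 _ _ (biprod.uniqueUpToIso _ _ b)).resolve_left hy
  have : Epi i := Preadditive.epi_of_cokernel_zero (h0.eq_of_tgt _ _)
  exact isIso_of_epi_of_isSplitMono i

variable [IsGrothendieckAbelian.{v} C] {x : C}

/-- An indecomposable singleton is simple, since all its subobjects are direct summands. -/
theorem IsSingleton.isDivisionRing_end (hx : IsSingleton x) (hind : Indecomposable x) :
    IsDivisionRing (End x) := by
  have hsplit {y z : C} (i : y ⟶ z) [Mono i] : IsSplitMono i := by
    have := hx.injective y
    exact ⟨⟨⟨Injective.factorThru (𝟙 y) i, Injective.comp_factorThru _ _⟩⟩⟩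
  refine ⟨⟨⟨0, 1, fun h => hind.1 ((IsZero.iff_id_eq_zero x).2 h.symm)⟩⟩, fun f hf => ?_⟩
  rw [isUnit_iff_isIso]
  let i := Abelian.image.ι f.asHom
  let p := Abelian.factorThruImage f.asHom
  have hfac : p ≫ i = f.asHom := Abelian.image.fac _
  have hp : p ≠ 0 := fun h => hf (hfac.symm.trans (by rw [h, zero_comp]))
  have := hsplit i
  have hi : IsIso i := hind.isIso_of_isSplitMono i fun h0 => hp (h0.eq_of_tgt _ _)
  have hk : IsZero (kernel p) := by
    by_contra hk
    have := hsplit (kernel.ι p)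
    have := hind.isIso_of_isSplitMono (kernel.ι p) hk
    exact hp ((cancel_epi (kernel.ι p)).1 (by rw [kernel.condition, comp_zero]))
  have : Mono p := Preadditive.mono_of_kernel_zero (hk.eq_of_src _ _)
  have : IsIso p := isIso_of_mono_of_epi p
  have : IsIso (p ≫ i) := inferInstance
  rwa [hfac] at this

/-- If `x` is a separator whose endomorphism ring is a division ring, then the Gabriel-Popescu
embedding `Hom(x, -)` is an equivalence. The unit of the adjunction is a monomorphism, because a
non-zero vector in its kernel would split off a copy of `Hom(x, x)`, on which the unit is a split
monomorphism. So the left adjoint is faithful, and it takes the unit to an isomorphism. -/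
theorem nonempty_equivalence_of_isSeparator (hx : IsSeparator x) (hdiv : IsDivisionRing (End x)) :
    ∃ (D : Type v) (_ : DivisionRing D), Nonempty (C ≌ ModuleCat.{v} Dᵐᵒᵖ) := by
  have := hdiv.1
  let inst : DivisionRing (End x) :=
    DivisionRing.ofIsUnitOrEqZero fun a => (em (a = 0)).symm.imp_left (hdiv.2 a)
  refine ⟨End x, inst, ?_⟩
  have := IsGrothendieckAbelian.GabrielPopescu.full x hx
  have := (isSeparator_iff_faithful_preadditiveCoyonedaObj x).1 hx
  let R : C ⥤ ModuleCat (End x)ᵐᵒᵖ := preadditiveCoyonedaObj x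
  let L := IsGrothendieckAbelian.tensorObj x
  let adj : L ⊣ R := IsGrothendieckAbelian.tensorObjPreadditiveCoyonedaObjAdjunction x
  have hR : R.Full ∧ R.Faithful := ⟨‹_›, ‹_›⟩
  obtain ⟨_, _⟩ := hR
  have (M : ModuleCat (End x)ᵐᵒᵖ) : Mono (adj.unit.app M) := by
    rw [ModuleCat.mono_iff_injective, injective_iff_map_eq_zero]
    intro (m : M) hm
    by_contra hm0
    let j : R.obj x →ₗ[(End x)ᵐᵒᵖ] M := LinearMap.toSpanSingleton (End x)ᵐᵒᵖ M m ∘ₗ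
      (Preadditive.homSelfLinearEquivEndMulOpposite x).toLinearMap
    have hspan : Function.Injective (LinearMap.toSpanSingleton (End x)ᵐᵒᵖ M m) :=
      LinearMap.ker_eq_bot.1 (LinearMap.ker_toSpanSingleton _ hm0)
    have hj : LinearMap.ker j = ⊥ := LinearMap.ker_eq_bot.2
      (hspan.comp (Preadditive.homSelfLinearEquivEndMulOpposite x).injective)
    obtain ⟨r, hr⟩ := LinearMap.exists_leftInverse_of_injective j hj
    let j' : R.obj x ⟶ M := ModuleCat.ofHom j
    let r' : M ⟶ R.obj x := ModuleCat.ofHom r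
    have hjr : j' ≫ r' = 𝟙 _ := ModuleCat.hom_ext hr
    have hju : j' ≫ adj.unit.app M = 0 := by
      refine ModuleCat.hom_ext (LinearMap.ext fun a => ?_)
      change (adj.unit.app M).hom (MulOpposite.op (show End x from a) • m) = 0
      rw [map_smul]
      exact (congrArg _ hm).trans (smul_zero _)
    have h0 : adj.unit.app (R.obj x) = 0 := by
      rw [← Category.comp_id (adj.unit.app (R.obj x)), ← (L ⋙ R).map_id, ← hjr, Functor.map_comp,
        ← Category.assoc, ← adj.unit.naturality, Functor.id_map, hju, zero_comp]
    have h2 := adj.right_triangle_components x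
    rw [h0, zero_comp] at h2
    exact hdiv.not_isZero ((IsZero.iff_id_eq_zero x).2 (R.map_injective
      ((R.map_id x).trans (h2.symm.trans (R.map_zero x x).symm))))
  have : L.Faithful := adj.faithful_L_of_mono_unit_app
  have : L.ReflectsIsomorphisms :=
    reflectsIsomorphisms_of_reflectsMonomorphisms_of_reflectsEpimorphisms L
  have (M : ModuleCat (End x)ᵐᵒᵖ) : IsIso (adj.unit.app M) := by
    have : IsIso (𝟙 (L.obj M)) := ⟨𝟙 _, by simp, by simp⟩
    have : IsIso (L.map (adj.unit.app M)) :=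
      IsIso.of_isIso_fac_right (adj.left_triangle_components M)
    exact isIso_of_reflects_iso _ L
  exact ⟨adj.toEquivalence.symm⟩

end Grothendieck

/-! ### Reduced modules and right vector spaces -/

/-- The endomorphisms of the right module `A` are the left multiplications. -/
noncomputable def endSelfMulEquiv (A : Type v) [Ring A] : End (ReducedModuleCat.self A) ≃* A :=
  ((isReducedModule A).fullyFaithfulι.mulEquivEnd _).trans <|
    (ModuleCat.endRingEquiv (ModuleCat.of Aᵐᵒᵖ A)).toMulEquiv.trans
      (RingEquiv.moduleEndSelfOp A).symm.toMulEquiv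

/-- The zero ring has no reduced modules but zero. -/
theorem isZero_of_equivalence_reducedModuleCat {C : Type u} [Category.{v} C]
    [HasZeroMorphisms C] {A : Type v} [Ring A] (h : (1 : A) = 0) (E : C ≌ ReducedModuleCat A)
    (X : C) : IsZero X := by
  refine (IsZero.iff_id_eq_zero X).2 (E.functor.map_injective ?_)
  refine ObjectProperty.hom_ext _ (ModuleCat.hom_ext (LinearMap.ext fun m => ?_))
  have hz (a : (E.functor.obj X).obj) : a = 0 := by
    rw [← one_smul Aᵐᵒᵖ a, ← MulOpposite.op_one, h, MulOpposite.op_zero, zero_smul]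
  exact (hz _).trans (hz _).symm

/-- A basis of a right vector space over `D` presents it as a coproduct of copies of `D`. -/
theorem isSingleton_self_of_divisionRing (D : Type v) [DivisionRing D] :
    IsSingleton (ModuleCat.of Dᵐᵒᵖ D) := by
  intro M
  let b := Module.Basis.ofVectorSpace Dᵐᵒᵖ M
  let f (s : Module.Basis.ofVectorSpaceIndex Dᵐᵒᵖ M) : D →ₗ[Dᵐᵒᵖ] M :=
    { toFun := fun d => MulOpposite.op d • b s
      map_add' := fun c d => by rw [MulOpposite.op_add, add_smul]
      map_smul' := fun r d => by
        rw [RingHom.id_apply, smul_smul, MulOpposite.smul_eq_mul_unop, MulOpposite.op_mul,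
          MulOpposite.op_unop] }
  have hf1 (s) : f s (1 : D) = b s := one_smul Dᵐᵒᵖ (b s)
  have hext {N : ModuleCat.{v} Dᵐᵒᵖ} {g h : ModuleCat.of Dᵐᵒᵖ D ⟶ N}
      (hgh : g.hom (1 : D) = h.hom (1 : D)) : g = h := by
    refine ModuleCat.hom_ext (LinearMap.ext fun (d : D) => ?_)
    have hd : d = MulOpposite.op d • (1 : D) := (one_mul d).symm
    rw [hd]
    exact (g.hom.map_smul _ _).trans ((congrArg _ hgh).trans (h.hom.map_smul _ _).symm)
  refine ⟨_, fun s => ModuleCat.ofHom (f s), ⟨Cofan.IsColimit.mk _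
    (fun t => ModuleCat.ofHom (b.constr ℕ fun s => (t.inj s).hom (1 : D))) (fun t s => hext ?_)
    fun t m hm => ModuleCat.hom_ext (b.ext fun s => ?_)⟩⟩
  · change b.constr ℕ _ (f s (1 : D)) = _
    rw [hf1, b.constr_basis]
  · refine Eq.trans ?_ (b.constr_basis ℕ _ s).symm
    rw [← hm s, ← hf1]
    rfl

/-! ### The equivalences -/

theorem proposition3 (C : Type u) [Category.{v} C] [Abelian C] [IsGrothendieckAbelian.{v} C]
    (hC : ∃ X : C, ¬ IsZero X) :
    List.TFAE [
      ∃ (D : Type v) (_ : DivisionRing D), Nonempty (C ≌ ModuleCat.{v} Dᵐᵒᵖ),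
      ∃ x : C, IsSingleton x ∧ Indecomposable x,
      IsSingletonCategory C ∧
        ∀ (A : Type v) [Ring A], IsVonNeumannRegularRing A → IsRightSelfInjective A →
          Nonempty (C ≌ ReducedModuleCat A) → IsSingleton (ReducedModuleCat.self A) →
          IsDivisionRing A,
      IsSingletonCategory C ∧
        ∀ (A : Type v) [Ring A], IsVonNeumannRegularRing A → IsRightSelfInjective A →
          Nonempty (C ≌ ReducedModuleCat A) → IsFactor A ∧ IsTypeI A,
      ∃ (B : Type v) (_ : Ring B), IsVonNeumannRegularRing B ∧ IsRightSelfInjective B ∧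
        IsFactor B ∧ IsTypeI B ∧ Nonempty (C ≌ ReducedModuleCat B)] := by
  obtain ⟨X₀, hX₀⟩ := hC
  tfae_have 1 → 2 := by
    rintro ⟨D, _, ⟨e⟩⟩
    have hD : IsDivisionRing D := ⟨inferInstance, fun a ha => IsUnit.mk0 a ha⟩
    have φ : D ≃* End (e.inverse.obj (ModuleCat.of Dᵐᵒᵖ D)) :=
      (RingEquiv.moduleEndSelfOp D).toMulEquiv.trans <|
        (ModuleCat.endRingEquiv (ModuleCat.of Dᵐᵒᵖ D)).symm.toMulEquiv.trans
          (e.symm.fullyFaithfulFunctor.mulEquivEnd _)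
    exact ⟨_, (isSingleton_self_of_divisionRing D).of_equivalence e.symm,
      (hD.of_mulEquiv φ).indecomposable⟩
  tfae_have 2 → 3 := by
    rintro ⟨x, hx, hind⟩
    have hdiv := hx.isDivisionRing_end hind
    refine ⟨⟨x, hx⟩, fun A _ _ _ ⟨e⟩ hA => ?_⟩
    have hy := hA.of_equivalence e.symm
    -- the singleton that comes from `A` is a retract of `x`, which has no proper retracts but zero
    obtain ⟨r⟩ := hy.nonempty_retract hdiv.not_isZero
    obtain ⟨i⟩ := hdiv.nonempty_iso_of_retract r (hy.not_isZero hX₀)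
    exact hdiv.of_mulEquiv <| i.symm.conj.trans <|
      (e.symm.fullyFaithfulFunctor.mulEquivEnd _).symm.trans (endSelfMulEquiv A)
  tfae_have 3 → 2 := by
    rintro ⟨⟨x, hx⟩, h⟩
    obtain ⟨e, ⟨i⟩⟩ := hx.exists_equivalence_reducedModuleCat
    have hself : IsSingleton (ReducedModuleCat.self (End x)) :=
      (hx.of_equivalence e).of_iso i
    exact ⟨x, hx, (h (End x) hx.isVonNeumannRegularRing_end hx.isRightSelfInjective_end ⟨e⟩
      hself).indecomposable⟩
  tfae_have 2 → 4 := by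
    rintro ⟨x, hx, hind⟩
    refine ⟨⟨x, hx⟩, fun A _ _ _ ⟨e⟩ => ?_⟩
    obtain ⟨S, ι, ⟨h⟩⟩ := hx (e.inverse.obj (ReducedModuleCat.self A))
    let φ : End (e.inverse.obj (ReducedModuleCat.self A)) ≃* A :=
      (e.symm.fullyFaithfulFunctor.mulEquivEnd (ReducedModuleCat.self A)).symm.trans
        (endSelfMulEquiv A)
    have hX : ¬ IsZero (e.inverse.obj (ReducedModuleCat.self A)) := fun h0 =>
      hX₀ <| isZero_of_equivalence_reducedModuleCat
        (φ.symm.injective (h0.eq_of_src _ _)) e X₀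
    obtain ⟨hF, hI⟩ := isFactor_and_isTypeI_end (hx.isDivisionRing_end hind) hX h
    exact ⟨hF.of_mulEquiv φ, hI.of_mulEquiv φ⟩
  tfae_have 4 → 5 := by
    rintro ⟨⟨x, hx⟩, h⟩
    obtain ⟨e, -⟩ := hx.exists_equivalence_reducedModuleCat
    have hreg := hx.isVonNeumannRegularRing_end
    have hinj := hx.isRightSelfInjective_end
    obtain ⟨hF, hI⟩ := h (End x) hreg hinj ⟨e⟩
    exact ⟨End x, inferInstance, hreg, hinj, hF, hI, ⟨e⟩⟩
  tfae_have 5 → 1 := by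
    rintro ⟨B, _, hB, hinj, hF, ⟨e, he, -, hfaith⟩, ⟨E⟩⟩
    have he0 : e ≠ 0 := by
      rintro rfl
      exact hX₀ <| isZero_of_equivalence_reducedModuleCat
        (hfaith 1 ⟨IsIdempotentElem.one, Subring.one_mem _⟩ (zero_mul 1)) E X₀
    have hsep := isSeparator_fixedRightIdeal he.1 fun b hb =>
      (hF.eq_zero_or_eq_zero hB hinj hb).resolve_right he0
    have hdiv := he.isDivisionRing_end hF hB hinj he0
    exact nonempty_equivalence_of_isSeparator (hsep.of_equivalence E.symm) <|
      hdiv.of_mulEquiv <|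
        (ModuleCat.endRingEquiv (ModuleCat.of Bᵐᵒᵖ (fixedRightIdeal e))).symm.toMulEquiv.trans <|
          ((isReducedModule B).fullyFaithfulι.mulEquivEnd
            ⟨_, isReducedModule_fixedRightIdeal he.1⟩).symm.trans
          (E.symm.fullyFaithfulFunctor.mulEquivEnd _)
  tfae_finish
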